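/- A real $n\times n$ matrix is called a standardized Laplacian matrix if all its row sums are equal to $0$ and its off-diagonal entries are nonpositive and do not exceed $1/n$ in absolute value. Let $$h(n)=\sup\{\operatorname{Im}(\lambda) : \lambda\in\mathbb{C} \text{ is an eigenvalue of some standardized Laplacian matrix of order } n\},$$ and for integers $0\le k\le n-1$ let $$\lambda_k(n)=\frac1n\Bigl(k-\sum_{j=1}^{k}e^{-2\pi \mathrm{i}j/n}\Bigr).$$ If $n$ is an odd positive integer, then the supremum $h(n)$ is finite and $$h(n)=\frac{1}{2n}\cot\frac{\pi}{2n}.$$ Moreover, $h(n)=\operatorname{Im}\bigl(\lambda_{(n-1)/2}(n)\bigr)$, and $\lambda_{(n-1)/2}(n)$ is an eigenvalue of some standardized Laplacian matrix of order $n$, so the supremum is attained there. -/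

import Mathlib

/-- A real square matrix of order `n` is a standardized Laplacian matrix if its row sums are `0`
and its off-diagonal entries are nonpositive and do not exceed `1/n` in absolute value. -/
def IsStandardizedLaplacian {n : ℕ} (L : Matrix (Fin n) (Fin n) ℝ) : Prop :=
  (∀ i, ∑ j, L i j = 0) ∧ ∀ i j, i ≠ j → L i j ≤ 0 ∧ |L i j| ≤ 1 / (n : ℝ)

/-- The complex number `z` is an eigenvalue of the real square matrix `L`. -/
def IsComplexEigenvalue {n : ℕ} (L : Matrix (Fin n) (Fin n) ℝ) (z : ℂ) : Prop :=
  Module.End.HasEigenvalue (Matrix.toLin' (L.map (fun x : ℝ => (x : ℂ)))) z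

/-- The set of all (complex) eigenvalues of standardized Laplacian matrices of order `n`. -/
def stdLaplacianEigenvalues (n : ℕ) : Set ℂ :=
  {z | ∃ L : Matrix (Fin n) (Fin n) ℝ, IsStandardizedLaplacian L ∧ IsComplexEigenvalue L z}

/-- `h(n)`: the supremum of the imaginary parts of the eigenvalues of standardized Laplacian
matrices of order `n`. -/
noncomputable def stdLaplacianHeight (n : ℕ) : ℝ :=
  sSup (Complex.im '' stdLaplacianEigenvalues n)

/-- `λ_k(n) = n⁻¹ (k - e^{-2πi/n} - e^{-4πi/n} - ⋯ - e^{-2kπi/n})`. -/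
noncomputable def polygonVertex (n k : ℕ) : ℂ :=
  (n : ℂ)⁻¹ * ((k : ℂ) -
    ∑ j ∈ Finset.Icc 1 k, Complex.exp (-(2 * (j : ℂ) * (Real.pi : ℂ) * Complex.I) / (n : ℂ)))

/-!
The bound is an inequality of Pick for real matrices: if `|L i j - L j i| ≤ 2 * g`, then every
eigenvalue `z` of `L` has `z.im ≤ g * cot (π / (2 * n))`; for a standardized Laplacian matrix
`2 * g = 1 / n` will do. If `x` is an eigenvector for `z`, then `z.im * ∑ ‖x j‖ ^ 2` is
`∑ (L j k - L k j) / 2 * (conj (x j) * x k).im`, so the point is the bound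
`sum_abs_im_star_mul_le` for the sum of all `|(conj (x j) * x k).im|`. This sum does not change when
some `x j` are replaced by `-x j` and the entries are permuted. Hence the `x j` may be taken in the
closed upper half plane and sorted by argument, and then `(conj (x j) * x k).im ≥ 0` for `j < k`.
The sum becomes the Hermitian form of the matrix with entries `-i * sign (k - j)`. An eigenvector of
this matrix for `μ` is a geometric sequence of ratio `(μ + i) / (μ - i)`, and the two ends match only
if `(μ + i) ^ n = -(μ - i) ^ n`; with `μ = cot φ` this says `cos (n * φ) = 0`, so that `φ` cannot lie
below `π / (2 * n)` (`eq_zero_of_orderSign_eigenvector`).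

Conversely `polygonVertex n k` is an eigenvalue of the circulant matrix whose row `i` has the entry
`-1 / n` in the `k` places that follow `i` cyclically, with the powers of `e ^ (-2πi/n)` as
eigenvector. For odd `n` and `k = (n - 1) / 2` its imaginary part, a sum of sines, equals the bound.
-/

open Complex Matrix

/-! ### The Hermitian matrix with entries `-i * sign (k - j)` -/

/-- The sign of `k - j`, as a real number. -/
noncomputable def orderSign {n : ℕ} (j k : Fin n) : ℝ :=
  if j < k then 1 else if k < j then -1 else 0

theorem orderSign_swap {n : ℕ} (j k : Fin n) : orderSign k j = -orderSign j k := by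
  unfold orderSign
  rcases lt_trichotomy j k with h | h | h
  · simp [h, h.not_gt]
  · simp [h]
  · simp [h, h.not_gt]

/-- All eigenvalues of the Hermitian matrix `-i * sign (k - j)` are at most `cot (π / (2 * n))`. -/
theorem eq_zero_of_orderSign_eigenvector {n : ℕ} {v : Fin n → ℂ} {μ : ℝ}
    (hμ : Real.cot (Real.pi / (2 * (n : ℝ))) < μ)
    (hv : ∀ j, -I * ∑ k, (orderSign j k : ℂ) * v k = μ * v j) : v = 0 := by
  rcases n with _ | m
  · exact Subsingleton.elim _ _
  have hpi := Real.pi_pos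
  have hm : (0 : ℝ) < ((m + 1 : ℕ) : ℝ) := by positivity
  set α : ℝ := Real.pi / (2 * ((m + 1 : ℕ) : ℝ)) with hα
  have hα0 : 0 < α := by positivity
  have hα2 : α ≤ Real.pi / 2 := by
    rw [hα]
    apply div_le_div_of_nonneg_left hpi.le (by norm_num)
    have : (1 : ℝ) ≤ ((m + 1 : ℕ) : ℝ) := by push_cast; linarith [Nat.cast_nonneg (α := ℝ) m]
    linarith
  have hsα : 0 < Real.sin α := Real.sin_pos_of_pos_of_lt_pi hα0 (by linarith)
  have hcα : 0 ≤ Real.cos α := Real.cos_nonneg_of_mem_Icc ⟨by linarith, hα2⟩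
  rw [Real.cot_eq_cos_div_sin] at hμ
  have hμ0 : 0 < μ := lt_of_le_of_lt (by positivity) hμ
  rw [div_lt_iff₀ hsα] at hμ
  set φ : ℝ := Real.arctan (1 / μ) with hφ
  have hφ0 : 0 < φ := by rw [hφ]; exact Real.arctan_pos.2 (by positivity)
  have hφ2 : φ < Real.pi / 2 := Real.arctan_lt_pi_div_two _
  have hcφ : 0 < Real.cos φ := Real.cos_arctan_pos _
  have hsφ : 0 < Real.sin φ := Real.sin_pos_of_pos_of_lt_pi hφ0 (by linarith)
  have hφt : μ * Real.sin φ = Real.cos φ := by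
    have : Real.sin φ / Real.cos φ = 1 / μ := by
      rw [← Real.tan_eq_sin_div_cos, hφ, Real.tan_arctan]
    field_simp at this
    linarith
  have hφα : φ < α := by
    by_contra! h
    have h1 : 0 ≤ Real.sin (φ - α) :=
      Real.sin_nonneg_of_nonneg_of_le_pi (by linarith) (by linarith)
    rw [Real.sin_sub, ← hφt] at h1
    nlinarith
  -- Subtracting consecutive rows of the eigenvector equation gives a geometric recurrence.
  have hstep : ∀ (j : ℕ) (hj : j + 1 < m + 1),
      v ⟨j + 1, hj⟩ * (μ - I) = (μ + I) * v ⟨j, by omega⟩ := by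
    intro j hj
    have h1 := hv ⟨j + 1, hj⟩
    have h2 := hv ⟨j, by omega⟩
    have h3 : ∑ k, (orderSign ⟨j + 1, hj⟩ k : ℂ) * v k
        = ∑ k, (orderSign ⟨j, by omega⟩ k : ℂ) * v k
          - v ⟨j, by omega⟩ - v ⟨j + 1, hj⟩ := by
      rw [eq_sub_iff_add_eq, eq_sub_iff_add_eq,
        ← Fintype.sum_ite_eq (⟨j + 1, hj⟩ : Fin (m + 1)) v,
        ← Fintype.sum_ite_eq (⟨j, by omega⟩ : Fin (m + 1)) v,
        ← Finset.sum_add_distrib, ← Finset.sum_add_distrib]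
      refine Finset.sum_congr rfl fun k _ => ?_
      unfold orderSign
      simp only [Fin.lt_def, Fin.ext_iff]
      split_ifs <;> first | omega | (push_cast; ring)
    rw [h3] at h1
    linear_combination h2 - h1
  have hpow : ∀ (j : ℕ) (hj : j < m + 1),
      v ⟨j, hj⟩ * (μ - I) ^ j = (μ + I) ^ j * v 0 := by
    intro j
    induction j with
    | zero => intro hj; simp
    | succ j ih =>
      intro hj
      have := ih (by omega)
      linear_combination (μ - I) ^ j * hstep j hj + (μ + I) * this
  -- Adding the first and the last row closes the recurrence up to a sign.
  have hlast : v (Fin.last m) * (μ + I) = - (v 0 * (μ - I)) := by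
    have h1 := hv 0
    have h2 := hv (Fin.last m)
    have h3 : ∑ k, (orderSign 0 k : ℂ) * v k + ∑ k, (orderSign (Fin.last m) k : ℂ) * v k
        + v 0 = v (Fin.last m) := by
      rw [← Fintype.sum_ite_eq (0 : Fin (m + 1)) v,
        ← Fintype.sum_ite_eq (Fin.last m : Fin (m + 1)) v,
        ← Finset.sum_add_distrib, ← Finset.sum_add_distrib]
      refine Finset.sum_congr rfl fun k _ => ?_
      unfold orderSign
      simp only [Fin.lt_def, Fin.ext_iff, Fin.val_zero, Fin.val_last]
      have := k.2
      split_ifs <;> first | omega | (push_cast; ring)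
    linear_combination -h1 - h2 - I * h3
  have hpm : (μ : ℂ) - I ≠ 0 := fun h => by
    have := congrArg Complex.im h
    simp at this
  have hv0 : v 0 = 0 := by
    by_contra hne
    have h1 := hpow m (by omega)
    have h2 : v 0 * ((μ + I) ^ (m + 1) + (μ - I) ^ (m + 1)) = 0 := by
      change v (Fin.last m) * _ = _ at h1
      linear_combination (μ - I) ^ m * hlast - (μ + I) * h1
    have h3 := (mul_eq_zero.1 h2).resolve_left hne
    -- `φ` is the angle with `μ = cot φ`, so `sin φ * (μ ± i) = e ^ (± i φ)`.
    have hp : (Real.sin φ : ℂ) * (μ + I) = exp (φ * I) := by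
      rw [exp_mul_I, ← ofReal_cos, ← ofReal_sin, ← hφt]; push_cast; ring
    have hq : (Real.sin φ : ℂ) * (μ - I) = exp (-(φ * I)) := by
      rw [← neg_mul, exp_mul_I, Complex.cos_neg, Complex.sin_neg, ← ofReal_cos, ← ofReal_sin,
        ← hφt]
      push_cast; ring
    have h4 : exp (φ * I) ^ (m + 1) + exp (-(φ * I)) ^ (m + 1) = 0 := by
      rw [← hp, ← hq, mul_pow, mul_pow, ← mul_add, h3, mul_zero]
    have h5 : Real.cos (((m + 1 : ℕ) : ℝ) * φ) = 0 := by
      rw [← ofReal_eq_zero, ofReal_cos, Complex.cos]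
      rw [← exp_nat_mul, ← exp_nat_mul] at h4
      rw [div_eq_zero_iff]
      left
      rw [← h4]
      push_cast
      ring_nf
    have h6 : 0 < Real.cos (((m + 1 : ℕ) : ℝ) * φ) := by
      apply Real.cos_pos_of_mem_Ioo
      have h7 : ((m + 1 : ℕ) : ℝ) * φ < ((m + 1 : ℕ) : ℝ) * α := by gcongr
      have h8 : ((m + 1 : ℕ) : ℝ) * α = Real.pi / 2 := by rw [hα]; field_simp
      have h9 : 0 < ((m + 1 : ℕ) : ℝ) * φ := by positivity
      exact ⟨by linarith, by linarith⟩
    exact h6.ne' h5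
  funext j
  have := hpow j j.2
  rw [hv0, mul_zero] at this
  exact (mul_eq_zero.1 this).resolve_right (pow_ne_zero _ hpm)

open scoped ComplexOrder in
theorem sum_orderSign_mul_im_le {n : ℕ} (y : Fin n → ℂ) :
    ∑ j, ∑ k, orderSign j k * (star (y j) * y k).im
      ≤ Real.cot (Real.pi / (2 * (n : ℝ))) * ∑ j, ‖y j‖ ^ 2 := by
  set c := Real.cot (Real.pi / (2 * (n : ℝ))) with hc
  let H : Matrix (Fin n) (Fin n) ℂ :=
    Matrix.of fun j k => -I * (orderSign j k : ℂ)
  have hH : ∀ (v : Fin n → ℂ) j, (H *ᵥ v) j = -I * ∑ k, (orderSign j k : ℂ) * v k := by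
    intro v j
    simp [H, mulVec, dotProduct, Finset.mul_sum, mul_assoc]
  let M : Matrix (Fin n) (Fin n) ℂ := (c : ℂ) • 1 - H
  have hMv : ∀ (v : Fin n → ℂ) j, (M *ᵥ v) j = c * v j - (H *ᵥ v) j := by
    intro v j
    simp [M, sub_mulVec, smul_mulVec]
  have hM : M.IsHermitian := by
    apply IsHermitian.ext
    intro j k
    have hMjk : ∀ a b, M a b = c * (if a = b then 1 else 0) - -I * (orderSign a b : ℂ) := by
      intro a b
      simp [M, H, Matrix.one_apply]
    rw [hMjk, hMjk, orderSign_swap j k]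
    by_cases h : j = k
    · simp [h]
    · simp [h, Ne.symm h]
  have hpos : M.PosSemidef := by
    rw [hM.posSemidef_iff_eigenvalues_nonneg]
    intro i
    by_contra! hlt
    have hlt : hM.eigenvalues i < 0 := hlt
    have he := hM.mulVec_eigenvectorBasis i
    have hz := eq_zero_of_orderSign_eigenvector (v := ⇑(hM.eigenvectorBasis i))
      (μ := c - hM.eigenvalues i) (by rw [← hc]; linarith) (by
        intro j
        have h1 := congrFun he j
        rw [hMv] at h1
        rw [← hH]
        simp at h1 ⊢
        linear_combination -h1)
    have h1 := hM.eigenvectorBasis.orthonormal.ne_zero i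
    apply h1
    ext j
    exact congrFun hz j
  have h := hpos.re_dotProduct_nonneg y
  have h2 : (star y ⬝ᵥ M *ᵥ y).re
      = c * ∑ j, ‖y j‖ ^ 2 - ∑ j, ∑ k, orderSign j k * (star (y j) * y k).im := by
    rw [dotProduct, Complex.re_sum, Finset.mul_sum, ← Finset.sum_sub_distrib]
    refine Finset.sum_congr rfl fun j _ => ?_
    rw [hMv, hH, mul_sub, Complex.sub_re]
    congr 1
    · rw [← Complex.normSq_eq_norm_sq, Complex.normSq_apply]
      simp
      ring
    · rw [Finset.mul_sum, Finset.mul_sum, Complex.re_sum]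
      refine Finset.sum_congr rfl fun k _ => ?_
      simp
      ring
  have h : 0 ≤ (star y ⬝ᵥ M *ᵥ y).re := h
  linarith

/-! ### Pick's inequality -/

theorem sum_abs_im_star_mul_le {n : ℕ} (x : Fin n → ℂ) :
    ∑ j, ∑ k, |(star (x j) * x k).im|
      ≤ Real.cot (Real.pi / (2 * (n : ℝ))) * ∑ j, ‖x j‖ ^ 2 := by
  -- A change of sign moves every `x j` to the closed upper half plane.
  have hex : ∀ j, ∃ ε : ℝ, |ε| = 1 ∧ 0 ≤ ((ε : ℂ) * x j).im := by
    intro j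
    rcases le_total 0 (x j).im with h | h
    · exact ⟨1, by simp, by simpa using h⟩
    · exact ⟨-1, by simp, by simpa using h⟩
  choose ε hε hεx using hex
  let z : Fin n → ℂ := fun j => (ε j : ℂ) * x j
  have hz : ∀ j k, |(star (z j) * z k).im| = |(star (x j) * x k).im| := by
    intro j k
    have : star (z j) * z k = ((ε j * ε k : ℝ) : ℂ) * (star (x j) * x k) := by
      simp [z]; ring
    rw [this, Complex.im_ofReal_mul, abs_mul, abs_mul, hε, hε, one_mul, one_mul]
  have hzn : ∀ j, ‖z j‖ = ‖x j‖ := by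
    intro j
    simp [z, hε]
  -- Arguments in `[0, π]`, sorted increasingly, differ by at most `π`, where `sin` is nonnegative.
  let σ := Tuple.sort (fun j => arg (z j))
  have hσ : Monotone ((fun j => arg (z j)) ∘ σ) := Tuple.monotone_sort _
  have him : ∀ j k, j ≤ k → 0 ≤ (star (z (σ j)) * z (σ k)).im := by
    intro j k hjk
    have h1 : arg (z (σ j)) ≤ arg (z (σ k)) := hσ hjk
    have h2 : 0 ≤ arg (z (σ j)) := Complex.arg_nonneg_iff.2 (hεx _)
    have h3 := Complex.arg_le_pi (z (σ k))
    have h4 : 0 ≤ Real.sin (arg (z (σ k)) - arg (z (σ j))) :=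
      Real.sin_nonneg_of_nonneg_of_le_pi (by linarith) (by linarith)
    have h5 : (star (z (σ j)) * z (σ k)).im
        = ‖z (σ j)‖ * ‖z (σ k)‖ * Real.sin (arg (z (σ k)) - arg (z (σ j))) := by
      rw [Real.sin_sub]
      have a1 := Complex.norm_mul_cos_arg (z (σ j))
      have a2 := Complex.norm_mul_sin_arg (z (σ j))
      have a3 := Complex.norm_mul_cos_arg (z (σ k))
      have a4 := Complex.norm_mul_sin_arg (z (σ k))
      simp only [Complex.mul_im, Complex.star_def, Complex.conj_re, Complex.conj_im]
      rw [← a1, ← a2, ← a3, ← a4]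
      ring
    rw [h5]
    positivity
  have hmain := sum_orderSign_mul_im_le (fun j => z (σ j))
  have hR : ∑ j, ‖z (σ j)‖ ^ 2 = ∑ j, ‖x j‖ ^ 2 := by
    rw [Equiv.sum_comp σ (fun j => ‖z j‖ ^ 2)]
    simp [hzn]
  have hL : ∑ j, ∑ k, orderSign j k * (star (z (σ j)) * z (σ k)).im
      = ∑ j, ∑ k, |(star (x j) * x k).im| := by
    calc _ = ∑ j, ∑ k, |(star (z (σ j)) * z (σ k)).im| := by
          refine Finset.sum_congr rfl fun j _ => Finset.sum_congr rfl fun k _ => ?_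
          have hanti : (star (z (σ j)) * z (σ k)).im = -(star (z (σ k)) * z (σ j)).im := by
            simp; ring
          unfold orderSign
          rcases lt_trichotomy j k with h | h | h
          · rw [if_pos h, abs_of_nonneg (him j k h.le), one_mul]
          · subst h
            have : (star (z (σ j)) * z (σ j)).im = 0 := by linarith
            rw [this]
            simp
          · rw [if_neg h.not_gt, if_pos h, hanti, abs_neg, abs_of_nonneg (him k j h.le)]
            ring
      _ = ∑ j, ∑ k, |(star (z j) * z k).im| := by
          rw [← Equiv.sum_comp σ (fun j => ∑ k, |(star (z j) * z k).im|)]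
          refine Finset.sum_congr rfl fun j _ => ?_
          rw [← Equiv.sum_comp σ (fun k => |(star (z (σ j)) * z k).im|)]
      _ = _ := by simp only [hz]
  rw [hL, hR] at hmain
  exact hmain

/-- Pick's inequality: the imaginary parts of the eigenvalues of a real matrix are bounded in terms of
the largest entry of its skew-symmetric part. -/
theorem im_le_of_abs_sub_le {n : ℕ} {L : Matrix (Fin n) (Fin n) ℝ} {g : ℝ}
    (hL : ∀ i j, |L i j - L j i| ≤ 2 * g) {z : ℂ} (hz : IsComplexEigenvalue L z) :
    z.im ≤ g * Real.cot (Real.pi / (2 * (n : ℝ))) := by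
  obtain ⟨x, hx⟩ := hz.exists_hasEigenvector
  have hne := hx.2
  have heq := hx.apply_eq_smul
  rw [Matrix.toLin'_apply] at heq
  have hS : 0 < ∑ j, ‖x j‖ ^ 2 := by
    obtain ⟨j, hj⟩ := Function.ne_iff.1 hne
    exact Finset.sum_pos' (fun _ _ => by positivity)
      ⟨j, Finset.mem_univ _, by have := norm_pos_iff.2 hj; positivity⟩
  have h1 : z.im * ∑ j, ‖x j‖ ^ 2 = ∑ j, ∑ k, L j k * (star (x j) * x k).im := by
    rw [Finset.mul_sum]
    refine Finset.sum_congr rfl fun j _ => ?_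
    have h2 := congrFun heq j
    have h3 : (star (x j) * (z * x j)).im = z.im * ‖x j‖ ^ 2 := by
      rw [← Complex.normSq_eq_norm_sq, Complex.normSq_apply]
      simp
      ring
    rw [← h3, ← smul_eq_mul z, ← Pi.smul_apply, ← h2]
    simp only [mulVec, dotProduct, Finset.mul_sum, Complex.im_sum, Matrix.map_apply]
    refine Finset.sum_congr rfl fun k _ => ?_
    rw [mul_left_comm, Complex.im_ofReal_mul]
  have h2 : 2 * (z.im * ∑ j, ‖x j‖ ^ 2)
      = ∑ j, ∑ k, (L j k - L k j) * (star (x j) * x k).im := by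
    have h4 : ∑ j, ∑ k, L k j * (star (x j) * x k).im
        = -∑ j, ∑ k, L j k * (star (x j) * x k).im := by
      rw [Finset.sum_comm]
      simp only [← Finset.sum_neg_distrib]
      refine Finset.sum_congr rfl fun j _ => Finset.sum_congr rfl fun k _ => ?_
      simp
      ring
    simp only [sub_mul, Finset.sum_sub_distrib]
    rw [h4, h1]
    ring
  have h3 : ∑ j, ∑ k, (L j k - L k j) * (star (x j) * x k).im
      ≤ 2 * g * ∑ j, ∑ k, |(star (x j) * x k).im| := by
    simp only [Finset.mul_sum]
    refine Finset.sum_le_sum fun j _ => Finset.sum_le_sum fun k _ => ?_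
    calc _ ≤ |(L j k - L k j) * (star (x j) * x k).im| := le_abs_self _
      _ = |L j k - L k j| * |(star (x j) * x k).im| := abs_mul _ _
      _ ≤ _ := by gcongr; exact hL j k
  rcases isEmpty_or_nonempty (Fin n) with he | ⟨⟨i⟩⟩
  · simp at hS
  have hg : 0 ≤ g := by have := hL i i; simp at this; linarith
  have h4 := mul_le_mul_of_nonneg_left (sum_abs_im_star_mul_le x) hg
  have h5 : z.im * ∑ j, ‖x j‖ ^ 2
      ≤ (g * Real.cot (Real.pi / (2 * (n : ℝ)))) * ∑ j, ‖x j‖ ^ 2 := by linarith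
  exact le_of_mul_le_mul_right h5 hS

theorem im_le_of_mem_stdLaplacianEigenvalues {n : ℕ} {z : ℂ}
    (hz : z ∈ stdLaplacianEigenvalues n) :
    z.im ≤ 1 / (2 * (n : ℝ)) * Real.cot (Real.pi / (2 * (n : ℝ))) := by
  obtain ⟨L, hL, hev⟩ := hz
  refine im_le_of_abs_sub_le (L := L) (fun i j => ?_) hev
  have h0 : (2 : ℝ) * (1 / (2 * (n : ℝ))) = 1 / n := by
    rw [one_div, mul_inv, one_div]; ring
  rw [h0]
  rcases eq_or_ne i j with rfl | hij
  · simp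
  obtain ⟨a1, a2⟩ := hL.2 i j hij
  obtain ⟨b1, b2⟩ := hL.2 j i hij.symm
  rw [abs_le] at a2 b2 ⊢
  constructor <;> linarith

/-! ### The extremal circulant matrix -/

/-- The circulant matrix with diagonal entries `k / n` whose row `i` has the entry `-1 / n` in the
columns `i + 1, …, i + k` modulo `n` and zeros elsewhere (for `k < n`). Subtraction in `Fin n` is
cyclic, so `(j - i).val` is the cyclic distance from `i` to `j`. -/
noncomputable def circulantLaplacian (n k : ℕ) : Matrix (Fin n) (Fin n) ℝ := fun i j =>
  if j = i then (k : ℝ) / n else if (j - i : Fin n).val ≤ k then -(1 / (n : ℝ)) else 0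

theorem sum_circulantLaplacian_mul {n k : ℕ} (hk : k < n) (i : Fin n) (f : Fin n → ℂ) :
    ∑ j, (circulantLaplacian n k i j : ℂ) * f j
      = (n : ℂ)⁻¹ * (k * f i - ∑ d ∈ Finset.Icc 1 k,
          f ⟨(i.val + d) % n, Nat.mod_lt _ (by omega)⟩) := by
  have : NeZero n := ⟨by omega⟩
  rw [← Equiv.sum_comp (Equiv.addLeft i)]
  simp only [Equiv.coe_addLeft]
  have h1 : ∀ d : Fin n, (circulantLaplacian n k i (i + d) : ℂ) * f (i + d)
      = (fun e : ℕ => (if e = 0 then (k : ℂ) / n else if e ≤ k then -(1 / (n : ℂ)) else 0)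
          * f ⟨(i.val + e) % n, Nat.mod_lt _ (by omega)⟩) d.val := by
    intro d
    have h2 : i + d = ⟨(i.val + d.val) % n, Nat.mod_lt _ (by omega)⟩ := by
      ext; simp [Fin.val_add]
    rw [circulantLaplacian]
    beta_reduce
    rw [← h2]
    simp only [add_eq_left, add_sub_cancel_left, Fin.ext_iff, Fin.val_zero]
    congr 1
    split_ifs <;> simp
  rw [Finset.sum_congr rfl fun d _ => h1 d, Fin.sum_univ_eq_sum_range
    (fun e : ℕ => (if e = 0 then (k : ℂ) / n else if e ≤ k then -(1 / (n : ℂ)) else 0)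
          * f ⟨(i.val + e) % n, Nat.mod_lt _ (by omega)⟩) n]
  -- Only the shifts `0, …, k` contribute.
  have hsub : insert 0 (Finset.Icc 1 k) ⊆ Finset.range n := by
    intro e he
    simp at he ⊢
    omega
  rw [← Finset.sum_subset hsub]
  · rw [Finset.sum_insert (by simp), mul_sub, Finset.mul_sum, sub_eq_add_neg,
      ← Finset.sum_neg_distrib]
    congr 1
    · simp [Nat.mod_eq_of_lt i.2]
      ring
    · refine Finset.sum_congr rfl fun e he => ?_
      simp at he
      rw [if_neg (by omega), if_pos he.2]
      ring
  · intro e _ he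
    simp at he
    rw [if_neg he.1, if_neg (by omega), zero_mul]

theorem polygonVertex_mem_stdLaplacianEigenvalues {n k : ℕ} (hk : k < n) :
    polygonVertex n k ∈ stdLaplacianEigenvalues n := by
  have hn : (n : ℂ) ≠ 0 := by
    have : n ≠ 0 := by omega
    exact_mod_cast this
  refine ⟨circulantLaplacian n k, ⟨fun i => ?_, fun i j hij => ?_⟩, ?_⟩
  · have h := sum_circulantLaplacian_mul hk i (fun _ => 1)
    simp at h
    exact_mod_cast h
  · have h0 : (0 : ℝ) ≤ 1 / n := by positivity
    rw [circulantLaplacian, if_neg hij.symm]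
    split_ifs
    · exact ⟨by linarith, by rw [abs_neg, abs_of_nonneg h0]⟩
    · exact ⟨le_rfl, by simp⟩
  · set ω : ℂ := exp (-(2 * Real.pi * I) / n) with hω
    have hωn : ω ^ n = 1 := by
      rw [hω, ← exp_nat_mul, mul_div_cancel₀ _ hn, exp_neg, exp_two_pi_mul_I, inv_one]
    refine Module.End.hasEigenvalue_of_hasEigenvector (x := fun j : Fin n => ω ^ j.val)
      (Module.End.hasEigenvector_iff.2 ⟨?_, ?_⟩)
    · rw [Module.End.mem_eigenspace_iff]
      funext i
      rw [Matrix.toLin'_apply]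
      have h := sum_circulantLaplacian_mul hk i (fun j : Fin n => ω ^ j.val)
      simp only [mulVec, dotProduct, Matrix.map_apply, Pi.smul_apply, smul_eq_mul]
      rw [h, polygonVertex, mul_assoc, sub_mul, Finset.sum_mul]
      congr 2
      refine Finset.sum_congr rfl fun d _ => ?_
      -- The exponent matters only modulo the order of `ω`, which divides `n`.
      rw [← pow_mod_orderOf, Nat.mod_mod_of_dvd _ (orderOf_dvd_of_pow_eq_one hωn),
        pow_mod_orderOf, pow_add, mul_comm]
      congr 1
      rw [hω, ← exp_nat_mul]
      congr 1
      ring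
    · intro h
      have := congrFun h ⟨0, by omega⟩
      simp at this

/-! ### The imaginary part of the extremal eigenvalue -/

theorem two_mul_sin_mul_sum_sin (θ : ℝ) (k : ℕ) :
    2 * Real.sin θ * ∑ j ∈ Finset.Icc 1 k, Real.sin (2 * j * θ)
      = Real.cos θ - Real.cos ((2 * k + 1) * θ) := by
  induction k with
  | zero => simp
  | succ k ih =>
    rw [Finset.sum_Icc_succ_top (by omega), mul_add, ih]
    have h1 : (2 * (k : ℝ) + 1) * θ = 2 * ((k + 1 : ℕ) : ℝ) * θ - θ := by push_cast; ring
    have h2 : (2 * ((k + 1 : ℕ) : ℝ) + 1) * θ = 2 * ((k + 1 : ℕ) : ℝ) * θ + θ := by ring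
    rw [h1, h2, Real.cos_sub, Real.cos_add]
    ring

theorem polygonVertex_im (n k : ℕ) :
    (polygonVertex n k).im
      = (n : ℝ)⁻¹ * ∑ j ∈ Finset.Icc 1 k, Real.sin (2 * j * (Real.pi / n)) := by
  have h : ∀ j : ℕ, exp (-(2 * (j : ℂ) * (Real.pi : ℂ) * I) / (n : ℂ))
      = exp ((-(2 * j * (Real.pi / n)) : ℝ) * I) := by
    intro j; congr 1; push_cast; ring
  have hc : ((n : ℂ)⁻¹) = (((n : ℝ)⁻¹ : ℝ) : ℂ) := by push_cast; rfl
  rw [polygonVertex, hc, Complex.im_ofReal_mul, Complex.sub_im, Complex.im_sum]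
  simp only [h, Complex.exp_ofReal_mul_I_im, Real.sin_neg, Finset.sum_neg_distrib,
    Complex.natCast_im]
  ring

/-- Here `2 * j * π / n` runs over the multiples below `π` of `2 * π / n`, and the telescoped sum of
sines is `(1 + cos (π / n)) / (2 * sin (π / n)) = cot (π / (2 * n)) / 2`. -/
theorem polygonVertex_half_im {n : ℕ} (hn : Odd n) :
    (polygonVertex n ((n - 1) / 2)).im
      = 1 / (2 * (n : ℝ)) * Real.cot (Real.pi / (2 * (n : ℝ))) := by
  obtain ⟨k, rfl⟩ := hn
  have hk : (2 * k + 1 - 1) / 2 = k := by omega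
  rw [hk, polygonVertex_im]
  rcases Nat.eq_zero_or_pos k with rfl | hk0
  -- For `n = 1` the sum is empty and `cot (π / 2) = 0`.
  · simp [Real.cot_eq_cos_div_sin]
  have hpi := Real.pi_pos
  set N : ℝ := ((2 * k + 1 : ℕ) : ℝ) with hN
  have hN1 : 1 < N := by rw [hN]; exact_mod_cast (by omega : 1 < 2 * k + 1)
  have hα : Real.pi / N = 2 * (Real.pi / (2 * N)) := by field_simp
  set α := Real.pi / (2 * N) with hαd
  have hα0 : 0 < α := by positivity
  have hα1 : α < Real.pi / 2 := by
    rw [hαd]; exact div_lt_div_of_pos_left hpi (by norm_num) (by linarith)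
  have hs : 0 < Real.sin α := Real.sin_pos_of_pos_of_lt_pi hα0 (by linarith)
  have hc : 0 < Real.cos α := Real.cos_pos_of_mem_Ioo ⟨by linarith, hα1⟩
  have h := two_mul_sin_mul_sum_sin (Real.pi / N) k
  have hlast : (2 * (k : ℝ) + 1) * (Real.pi / N) = Real.pi := by
    have : 2 * (k : ℝ) + 1 = N := by rw [hN]; push_cast; ring
    rw [this]; field_simp
  rw [hlast, Real.cos_pi] at h
  set S := ∑ j ∈ Finset.Icc 1 k, Real.sin (2 * j * (Real.pi / N)) with hS
  rw [hα, Real.sin_two_mul, Real.cos_two_mul] at h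
  have h2 : 2 * Real.sin α * S = Real.cos α := by
    apply mul_left_cancel₀ (mul_pos two_pos hc).ne'
    linear_combination h
  rw [Real.cot_eq_cos_div_sin, ← h2]
  field_simp

theorem theorem10 (n : ℕ) (hn : Odd n) :
    IsLUB (Complex.im '' stdLaplacianEigenvalues n) (stdLaplacianHeight n) ∧
    stdLaplacianHeight n = 1 / (2 * (n : ℝ)) * Real.cot (Real.pi / (2 * (n : ℝ))) ∧
    polygonVertex n ((n - 1) / 2) ∈ stdLaplacianEigenvalues n ∧
    stdLaplacianHeight n = (polygonVertex n ((n - 1) / 2)).im := by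
  have hmem : polygonVertex n ((n - 1) / 2) ∈ stdLaplacianEigenvalues n :=
    polygonVertex_mem_stdLaplacianEigenvalues (by have := hn.pos; omega)
  have hgreatest : IsGreatest (Complex.im '' stdLaplacianEigenvalues n)
      (polygonVertex n ((n - 1) / 2)).im := by
    refine ⟨Set.mem_image_of_mem _ hmem, ?_⟩
    rintro _ ⟨z, hz, rfl⟩
    rw [polygonVertex_half_im hn]
    exact im_le_of_mem_stdLaplacianEigenvalues hz
  have hh : stdLaplacianHeight n = (polygonVertex n ((n - 1) / 2)).im := hgreatest.csSup_eq
  refine ⟨?_, ?_, hmem, hh⟩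
  · rw [hh]
    exact hgreatest.isLUB
  · rw [hh, polygonVertex_half_im hn]
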